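/- Let $d,m\ge 0$ and $L\ge 1$ be integers, let $T>0$, and let $\Omega\subset\mathbb R^d$ be a bounded open set with continuous boundary (near each boundary point, in suitable orthonormal coordinates, $\Omega$ is the region strictly above the graph of a continuous function). Write $\mathcal T=[0,T]$. Let $\sigma:\mathbb R\to\mathbb R$ be a bounded, non-constant function of class $C^m$ (for example a sigmoid function of class $C^m$). Let $\mathcal A_d(\sigma)$ be the set of all fully connected feedforward networks with exactly $L$ hidden layers, of arbitrary widths, with activation $\sigma$ and linear scalar output, i.e. of all functions $$\xi(x,t)=\sum_{i=1}^{n}c_i\,\sigma\bigl(z^L_i(x,t)\bigr),\qquad n\ge1,\ c_i\in\mathbb R,$$ where $z^1(x,t)=\mathbf w^1\,(x,t)+\mathbf b^1$ and $z^{l+1}(x,t)=\mathbf w^{l+1}\sigma(z^{l}(x,t))+\mathbf b^{l+1}$ for $1\le l<L$, with arbitrary widths $n_l\ge 1$, real weight matrices $\mathbf w^l$ and bias vectors $\mathbf b^l$ ($\sigma$ acts componentwise, and $n_L=n$). Let $C^m(\bar\Omega\times\mathcal T)$ be the set of continuous functions $f:\bar\Omega\times\mathcal T\to\mathbb R$ that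 are of class $C^m$ in $\Omega\times(0,T)$ and whose partial derivatives $\nabla^\alpha f$, $|\alpha|\le m$, all extend continuously to $\bar\Omega\times\mathcal T$ (the extensions are again denoted by $\nabla^\alpha f$). Then $\mathcal A_d(\sigma)$ is uniformly $m$-dense in $C^m(\bar\Omega\times\mathcal T)$: for every $f\in C^m(\bar\Omega\times\mathcal T)$ and every $\varepsilon>0$ there is $\xi\in\mathcal A_d(\sigma)$, of class $C^m$, such that $$\max_{|\alpha|\le m}\ \sup_{(x,t)\in\bar\Omega\times\mathcal T}\bigl|\nabla^\alpha \xi(x,t)-\nabla^\alpha f(x,t)\bigr|\le\varepsilon .$$ -/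

import Mathlib

open Set Filter Topology

/-- Space-time `ℝ^d × ℝ`, with points `z = (x, t)`. -/
abbrev SpaceTime (d : ℕ) : Type := EuclideanSpace ℝ (Fin d) × ℝ

/-- The coordinate directions of `ℝ^d × ℝ`: `Sum.inl i` is the spatial direction `x_i` and
`Sum.inr ()` is the time direction. -/
noncomputable def coordVec (d : ℕ) : Fin d ⊕ Unit → SpaceTime d :=
  Sum.elim (fun i => (EuclideanSpace.single i (1 : ℝ), 0)) (fun _ => (0, 1))

/-- The mixed partial derivative `∂_{j_1} ⋯ ∂_{j_k} f (z)` of order `k`. When `f` is `C^k` near `z`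
this is the derivative with multi-index `α`, where `α i` is the number of occurrences of the
coordinate `i` in `j`; every multi-index of order `k` arises in this way. -/
noncomputable def mixedPartial {d k : ℕ} (j : Fin k → Fin d ⊕ Unit) (f : SpaceTime d → ℝ)
    (z : SpaceTime d) : ℝ :=
  iteratedFDeriv ℝ k f z (fun a => coordVec d (j a))

/-- The function space `C^m(closure U)` of an open set `U`: `f` is continuous on the closure, `C^m`
on `U`, and all its partial derivatives of order at most `m` on `U` extend continuously to the
closure of `U`. -/
structure IsCmOnClosure {d : ℕ} (m : ℕ) (U : Set (SpaceTime d)) (f : SpaceTime d → ℝ) : Prop where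
  continuousOn : ContinuousOn f (closure U)
  contDiffOn : ContDiffOn ℝ m f U
  extends_derivs : ∀ k ≤ m, ∀ j : Fin k → Fin d ⊕ Unit,
    ∃ g : SpaceTime d → ℝ, ContinuousOn g (closure U) ∧ EqOn g (mixedPartial j f) U

/-- The continuous extension to the closure of `U` of the partial derivative `∂_{j_1} ⋯ ∂_{j_k} f`
on `U`: at a point `z` of the closure it is the limit of the derivative along `U` at `z`. -/
noncomputable def mixedPartialExt {d k : ℕ} (U : Set (SpaceTime d)) (j : Fin k → Fin d ⊕ Unit)
    (f : SpaceTime d → ℝ) : SpaceTime d → ℝ :=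
  extendFrom U (mixedPartial j f)

/-- The class `S` is uniformly `m`-dense in `C^m(closure U)`: every `f` in `C^m(closure U)` can be
approximated, with all partial derivatives of order at most `m` and uniformly on the closure of
`U`, by `C^m` members of `S`. -/
def UniformlyMDense {d : ℕ} (m : ℕ) (U : Set (SpaceTime d)) (S : Set (SpaceTime d → ℝ)) : Prop :=
  ∀ f : SpaceTime d → ℝ, IsCmOnClosure m U f → ∀ ε : ℝ, 0 < ε →
    ∃ ξ ∈ S, ContDiff ℝ m ξ ∧
      ∀ k ≤ m, ∀ j : Fin k → Fin d ⊕ Unit, ∀ z ∈ closure U,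
        |mixedPartial j ξ z - mixedPartialExt U j f z| ≤ ε

/-- `Ω` has continuous boundary: near every boundary point, in suitable orthonormal coordinates
with last axis `e`, the set `Ω` is the region strictly above the graph of a continuous function
`γ`. The point `x - ⟪e, x⟫ e` is the projection of `x` to the hyperplane orthogonal to `e`. -/
def HasContinuousBoundary {d : ℕ} (Ω : Set (EuclideanSpace ℝ (Fin d))) : Prop :=
  ∀ p ∈ frontier Ω, ∃ r : ℝ, 0 < r ∧ ∃ e : EuclideanSpace ℝ (Fin d), ‖e‖ = 1 ∧
    ∃ γ : EuclideanSpace ℝ (Fin d) → ℝ, Continuous γ ∧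
      ∀ x ∈ Metric.ball p r, x ∈ Ω ↔ γ (x - inner ℝ e x • e) < inner ℝ e x

/-- `IsLayerInput d σ l n y`: the map `y : ℝ^d × ℝ → ℝ^n` is the vector of inputs
(pre-activations) of the `l`-th hidden layer, which has `n ≥ 1` units, of a fully connected
feedforward network with activation `σ`, for some choice of the widths of the previous layers and
of the weights and biases. -/
inductive IsLayerInput (d : ℕ) (σ : ℝ → ℝ) :
    ℕ → (n : ℕ) → (SpaceTime d → Fin n → ℝ) → Prop
  | first {n : ℕ} (hn : 0 < n) (w : Matrix (Fin n) (Fin d) ℝ) (v b : Fin n → ℝ) :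
      IsLayerInput d σ 1 n (fun z i => ∑ k, w i k * z.1 k + v i * z.2 + b i)
  | next {l n n' : ℕ} {y : SpaceTime d → Fin n → ℝ} (hy : IsLayerInput d σ l n y) (hn : 0 < n')
      (w : Matrix (Fin n') (Fin n) ℝ) (b : Fin n' → ℝ) :
      IsLayerInput d σ (l + 1) n' (fun z i => ∑ k, w i k * σ (y z k) + b i)

/-- The class `𝒜_d(σ)` of scalar networks on `ℝ^d × ℝ` with exactly `L` hidden layers: functions
`∑ i, c i * σ (y_i(x, t))`, with `y` the inputs of the `L`-th hidden layer, of any width. -/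
def deepNetworks (d L : ℕ) (σ : ℝ → ℝ) : Set (SpaceTime d → ℝ) :=
  {ξ | ∃ (n : ℕ) (y : SpaceTime d → Fin n → ℝ) (c : Fin n → ℝ),
    IsLayerInput d σ L n y ∧ ξ = fun z => ∑ i, c i * σ (y z i)}

/-!
Fix a compact set `K` in space-time. The `C^m` functions are represented by their jets along `K`,
elements of the Banach space `C(K, Jet m V)` whose norm is uniform convergence on `K` of all
derivatives up to order `m`. Since jets commute with integration with respect to a parameter
(`jet_setIntegral`), a closed subspace of jets that contains a family of functions contains its
integrals and its derivatives with respect to parameters.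

*One hidden layer* (`mem_jetComap_of_ridge`). Let a closed subspace contain all ridge functions
`σ (l z + b)`. Integration gives the ridge functions of a mollification `g` of `σ`, which is smooth,
bounded and not constant, so that no derivative of `g` vanishes identically
(`exists_iterate_deriv_ne_zero`). Differentiating `g (l z + b)` in directions `l₁, …, lₖ` and putting
`l = 0` gives `g⁽ᵏ⁾(b) l₁ ⋯ lₖ`, hence all polynomials (`polyFunctions_le_jetComap`). Convolution with
normalized powers of a quadratic polynomial peaked at the origin then gives all `C^m` functions
(`mem_jetComap_of_hasCompactSupport`).

*Several hidden layers* (`mem_jetComap_networkSpace`). By the Faà di Bruno formula, the jet of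
`σ ∘ g` is a continuous function of the jet of `g`. By induction on the depth, linear forms are limits
of networks with one layer fewer, so the ridge functions `σ (l z + b)` are limits of networks, and
the result for one layer applies.

*Behaviour at the boundary* (`mem_closure_jet_of_hasSegmentProperty`). The cylinder `Ω × (0, T)` has
the segment property: locally, one direction pushes its closure into the cylinder. Combining these
directions with bump functions yields a smooth vector field `X` such that `z + s X z` maps the closure
into the open set for all small `s > 0`. The functions `f (z + s X z)` are `C^m` near the closure,
and, again by the Faà di Bruno formula, their jets converge to the continuous extension of the jet
of `f` as `s → 0`.
-/

/-! ### Jets of functions along a compact set -/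

/-- The space of `m`-jets of real functions at a point of `V`: one continuous multilinear form of
each degree `k ≤ m`, playing the role of the `k`-th derivative. -/
def Jet (m : ℕ) (V : Type*) [NormedAddCommGroup V] [NormedSpace ℝ V] : Type _ :=
  (k : Fin (m + 1)) → ContinuousMultilinearMap ℝ (fun _ : Fin k => V) ℝ

section Jets

variable {m : ℕ} {V : Type*} [NormedAddCommGroup V] [NormedSpace ℝ V]

noncomputable instance : NormedAddCommGroup (Jet m V) :=
  inferInstanceAs (NormedAddCommGroup ((k : Fin (m + 1)) →
    ContinuousMultilinearMap ℝ (fun _ : Fin k => V) ℝ))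

noncomputable instance : NormedSpace ℝ (Jet m V) :=
  inferInstanceAs (NormedSpace ℝ ((k : Fin (m + 1)) →
    ContinuousMultilinearMap ℝ (fun _ : Fin k => V) ℝ))

instance : CompleteSpace (Jet m V) :=
  inferInstanceAs (CompleteSpace ((k : Fin (m + 1)) →
    ContinuousMultilinearMap ℝ (fun _ : Fin k => V) ℝ))

/-- The component of degree `k` of a jet. -/
noncomputable def Jet.coeff (k : Fin (m + 1)) :
    Jet m V →L[ℝ] ContinuousMultilinearMap ℝ (fun _ : Fin k => V) ℝ :=
  ContinuousLinearMap.proj (R := ℝ) (φ := fun k : Fin (m + 1) =>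
    ContinuousMultilinearMap ℝ (fun _ : Fin k => V) ℝ) k

lemma Jet.ext {p q : Jet m V} (h : ∀ k, Jet.coeff k p = Jet.coeff k q) : p = q := funext h

lemma Jet.continuous_of_coeff {X : Type*} [TopologicalSpace X] {f : X → Jet m V}
    (h : ∀ k, Continuous fun x => Jet.coeff k (f x)) : Continuous f := continuous_pi h

lemma Jet.norm_coeff_le (p : Jet m V) (k : Fin (m + 1)) : ‖Jet.coeff k p‖ ≤ ‖p‖ :=
  norm_le_pi_norm (G := fun k : Fin (m + 1) =>
    ContinuousMultilinearMap ℝ (fun _ : Fin k => V) ℝ) p k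

lemma natCast_fin_le (k : Fin (m + 1)) : (((k : ℕ) : ℕ∞) : WithTop ℕ∞) ≤ (m : WithTop ℕ∞) := by
  exact_mod_cast Nat.lt_succ_iff.mp k.2

/-- The `m`-jet of a `C^m` function along the set `K`, as a continuous map on `K`. For compact `K`
the norm of `C(K, Jet m V)` is the norm of uniform convergence on `K` of all derivatives of order
at most `m`. -/
noncomputable def jet (K : Set V) (F : V → ℝ) (hF : ContDiff ℝ m F) : C(K, Jet m V) where
  toFun z k := iteratedFDeriv ℝ k F z
  continuous_toFun := Jet.continuous_of_coeff fun k =>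
    (hF.continuous_iteratedFDeriv (natCast_fin_le k)).comp continuous_subtype_val

lemma jet_congr {K U : Set V} (hU : IsOpen U) (hKU : K ⊆ U) {F G : V → ℝ}
    (hF : ContDiff ℝ m F) (hG : ContDiff ℝ m G) (h : EqOn F G U) : jet K F hF = jet K G hG := by
  ext1 z
  refine Jet.ext fun k => ?_
  exact (h.eventuallyEq_of_mem (hU.mem_nhds (hKU z.2))).iteratedFDeriv ℝ k |>.eq_of_nhds

lemma jet_add {K : Set V} {F G : V → ℝ} (hF : ContDiff ℝ m F) (hG : ContDiff ℝ m G) :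
    jet K (F + G) (hF.add hG) = jet K F hF + jet K G hG := by
  ext1 z
  refine Jet.ext fun k => ?_
  exact iteratedFDeriv_add_apply ((hF.of_le (natCast_fin_le k)).contDiffAt)
    ((hG.of_le (natCast_fin_le k)).contDiffAt)

lemma jet_smul {K : Set V} {F : V → ℝ} (hF : ContDiff ℝ m F) (a : ℝ) :
    jet K (a • F) (hF.const_smul a) = a • jet K F hF := by
  ext1 z
  refine Jet.ext fun k => ?_
  exact iteratedFDeriv_const_smul_apply ((hF.of_le (natCast_fin_le k)).contDiffAt)

/-- The `C^m` functions on `V` whose jets along `K` belong to the subspace `M`. -/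
def jetComap {K : Set V} (M : Submodule ℝ C(K, Jet m V)) : Submodule ℝ (V → ℝ) where
  carrier := {F | ∃ hF : ContDiff ℝ m F, jet K F hF ∈ M}
  zero_mem' := ⟨contDiff_const, by
    have h0 : ContDiff ℝ m (0 : V → ℝ) := contDiff_const
    have : jet K (0 : V → ℝ) h0 = (0 : ℝ) • jet K (0 : V → ℝ) h0 := by
      rw [← jet_smul]; congr 1; simp
    rw [this, zero_smul]
    exact M.zero_mem⟩
  add_mem' := by
    rintro F G ⟨hF, hF'⟩ ⟨hG, hG'⟩
    exact ⟨hF.add hG, by rw [jet_add hF hG]; exact M.add_mem hF' hG'⟩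
  smul_mem' := by
    rintro a F ⟨hF, hF'⟩
    exact ⟨hF.const_smul a, by rw [jet_smul hF]; exact M.smul_mem _ hF'⟩

/-- Whether the jet of a `C^m` function lies in `M` depends only on the function near `K`. -/
lemma mem_jetComap_congr {K U : Set V} {M : Submodule ℝ C(K, Jet m V)} (hU : IsOpen U)
    (hKU : K ⊆ U) {F G : V → ℝ} (hF : ContDiff ℝ m F) (hG : G ∈ jetComap M) (h : EqOn F G U) :
    F ∈ jetComap M := by
  obtain ⟨hG, hG'⟩ := hG
  exact ⟨hF, by rwa [jet_congr hU hKU hF hG h]⟩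

end Jets

/-! ### Integrals of jets depending on a parameter -/

section Parametric

open MeasureTheory

variable {m : ℕ} {V : Type*} [NormedAddCommGroup V] [NormedSpace ℝ V]
  {Y : Type*} [NormedAddCommGroup Y] [NormedSpace ℝ Y]

/-- The derivatives in `z` of a jointly `C^m` function `h y z` are jointly continuous. -/
lemma continuous_iteratedFDeriv_param {W : Type*} [NormedAddCommGroup W] [NormedSpace ℝ W]
    {h : Y → V → W} (hh : ContDiff ℝ m (fun p : Y × V => h p.1 p.2)) {k : ℕ} (hk : k ≤ m) :
    Continuous fun p : Y × V => iteratedFDeriv ℝ k (h p.1) p.2 := by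
  have key : ∀ p : Y × V, iteratedFDeriv ℝ k (h p.1) p.2 =
      (iteratedFDeriv ℝ k (fun p : Y × V => h p.1 p.2) p).compContinuousLinearMap
        fun _ => ContinuousLinearMap.inr ℝ Y V := by
    rintro ⟨y, z⟩
    have h1 : ContDiff ℝ m (fun q : Y × V => h ((y, 0) + q).1 ((y, 0) + q).2) :=
      hh.comp (contDiff_const.add contDiff_id)
    have h2 := (ContinuousLinearMap.inr ℝ Y V).iteratedFDeriv_comp_right h1 z (i := k)
      (by exact_mod_cast hk)
    rw [iteratedFDeriv_comp_add_left (f := fun p : Y × V => h p.1 p.2)] at h2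
    simpa [Function.comp_def] using h2
  simp_rw [key]
  exact (ContinuousMultilinearMap.compContinuousLinearMapL
    (fun _ : Fin k => ContinuousLinearMap.inr ℝ Y V)).continuous.comp
      (hh.continuous_iteratedFDeriv (by exact_mod_cast hk))

lemma contDiff_of_param {h : Y → V → ℝ} (hh : ContDiff ℝ m (fun p : Y × V => h p.1 p.2)) (y : Y) :
    ContDiff ℝ m (h y) :=
  hh.comp (contDiff_const.prodMk contDiff_id)

/-- The jet of `h y`, as a continuous function of the parameter `y`. -/
lemma continuous_jet_param {K : Set V} {h : Y → V → ℝ}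
    (hh : ContDiff ℝ m (fun p : Y × V => h p.1 p.2)) :
    Continuous fun y => jet K (h y) (contDiff_of_param hh y) := by
  refine ContinuousMap.continuous_of_continuous_uncurry _ (Jet.continuous_of_coeff fun k => ?_)
  exact (continuous_iteratedFDeriv_param hh (Nat.lt_succ_iff.mp k.2)).comp
    (continuous_fst.prodMk (continuous_subtype_val.comp continuous_snd))

variable [MeasurableSpace Y] [BorelSpace Y] {μ : Measure Y} [IsFiniteMeasureOnCompacts μ]
  [FiniteDimensional ℝ V]

/-- Differentiation under the integral sign, for all derivatives up to order `m` at once. -/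
lemma hasFTaylorSeriesUpTo_setIntegral {h : Y → V → ℝ}
    (hh : ContDiff ℝ m (fun p : Y × V => h p.1 p.2)) {S : Set Y} (hS : IsCompact S) :
    HasFTaylorSeriesUpTo m (fun z => ∫ y in S, h y z ∂μ)
      (fun z k => ∫ y in S, iteratedFDeriv ℝ k (h y) z ∂μ) := by
  have hcont : ∀ k ≤ m, ∀ z, Continuous fun y => iteratedFDeriv ℝ k (h y) z := fun k hk z =>
    (continuous_iteratedFDeriv_param hh hk).comp (continuous_id.prodMk continuous_const)
  have hint : ∀ k ≤ m, ∀ z, IntegrableOn (fun y => iteratedFDeriv ℝ k (h y) z) S μ :=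
    fun k hk z => (hcont k hk z).continuousOn.integrableOn_compact hS
  constructor
  · intro z
    have h0 := (continuousMultilinearCurryFin0 ℝ V ℝ).toContinuousLinearEquiv.integral_comp_comm
      (μ := μ.restrict S) (fun y => iteratedFDeriv ℝ 0 (h y) z)
    simpa [ContinuousMultilinearMap.curry0] using h0.symm
  · intro k hk z
    have hk' : k + 1 ≤ m := by
      have : k < m := by exact_mod_cast hk
      omega
    obtain ⟨C, hC⟩ := (hS.prod (isCompact_closedBall z 1)).exists_bound_of_continuousOn
      (continuous_iteratedFDeriv_param hh hk').continuousOn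
    have hcurry : ∀ y x, HasFDerivAt (fun x => iteratedFDeriv ℝ k (h y) x)
        ((iteratedFDeriv ℝ (k + 1) (h y) x).curryLeft) x := fun y x =>
      (contDiff_of_param hh y).ftaylorSeries.fderiv k hk x
    have hder := hasFDerivAt_integral_of_dominated_of_fderiv_le (𝕜 := ℝ) (μ := μ.restrict S)
      (F := fun x y => iteratedFDeriv ℝ k (h y) x)
      (F' := fun x y => (iteratedFDeriv ℝ (k + 1) (h y) x).curryLeft) (x₀ := z)
      (s := Metric.closedBall z 1) (bound := fun _ => C)
      (Metric.closedBall_mem_nhds z one_pos)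
      (Eventually.of_forall fun x => (hint k (by omega) x).aestronglyMeasurable)
      (hint k (by omega) z)
      ?_ ?_ (integrableOn_const hS.measure_lt_top.ne) ?_
    · refine hder.congr_fderiv ?_
      let e : ContinuousMultilinearMap ℝ (fun _ : Fin (k + 1) => V) ℝ →L[ℝ]
          (V →L[ℝ] ContinuousMultilinearMap ℝ (fun _ : Fin k => V) ℝ) :=
        (continuousMultilinearCurryLeftEquiv ℝ (fun _ : Fin (k + 1) => V)
          ℝ).toContinuousLinearEquiv
      exact (ContinuousLinearMap.integral_comp_comm (𝕜 := ℝ)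
        (Fₗ := V →L[ℝ] ContinuousMultilinearMap ℝ (fun _ : Fin k => V) ℝ)
        e (hint (k + 1) hk' z))
    · exact (continuousMultilinearCurryLeftEquiv ℝ (fun _ : Fin (k + 1) => V)
        ℝ).continuous.comp_aestronglyMeasurable (hint (k + 1) hk' z).aestronglyMeasurable
    · refine (ae_restrict_iff' hS.measurableSet).2 (Eventually.of_forall fun y hy x hx => ?_)
      rw [ContinuousMultilinearMap.curryLeft_norm]
      exact hC (y, x) ⟨hy, hx⟩
    · exact Eventually.of_forall fun y x _ => hcurry y x
  · intro k hk
    have hk' : k ≤ m := by exact_mod_cast hk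
    refine continuous_iff_continuousAt.2 fun z => ?_
    obtain ⟨C, hC⟩ := (hS.prod (isCompact_closedBall z 1)).exists_bound_of_continuousOn
      (continuous_iteratedFDeriv_param hh hk').continuousOn
    refine continuousAt_of_dominated (bound := fun _ => C)
      (Eventually.of_forall fun x => (hint k hk' x).aestronglyMeasurable) ?_
      (integrableOn_const hS.measure_lt_top.ne) ?_
    · filter_upwards [Metric.closedBall_mem_nhds z one_pos] with x hx
      exact (ae_restrict_iff' hS.measurableSet).2 (Eventually.of_forall fun y hy => hC (y, x) ⟨hy, hx⟩)
    · exact Eventually.of_forall fun y =>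
        ((continuous_iteratedFDeriv_param hh hk').comp
          (continuous_const.prodMk continuous_id)).continuousAt

lemma contDiff_setIntegral {h : Y → V → ℝ} (hh : ContDiff ℝ m (fun p : Y × V => h p.1 p.2))
    {S : Set Y} (hS : IsCompact S) : ContDiff ℝ m (fun z => ∫ y in S, h y z ∂μ) :=
  (hasFTaylorSeriesUpTo_setIntegral hh hS).contDiff


/-- The jet of an integral is the Bochner integral of the jets. -/
lemma jet_setIntegral {K : Set V} [CompactSpace K] {h : Y → V → ℝ}
    (hh : ContDiff ℝ m (fun p : Y × V => h p.1 p.2)) {S : Set Y} (hS : IsCompact S) :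
    jet K (fun z => ∫ y in S, h y z ∂μ) (contDiff_setIntegral hh hS) =
      ∫ y in S, jet K (h y) (contDiff_of_param hh y) ∂μ := by
  ext1 z
  refine Jet.ext fun k => ?_
  have hint : IntegrableOn (fun y => jet K (h y) (contDiff_of_param hh y)) S μ :=
    (continuous_jet_param hh).continuousOn.integrableOn_compact hS
  have h1 := ((Jet.coeff k).comp (ContinuousMap.evalCLM ℝ z)).integral_comp_comm hint
  refine Eq.trans ?_ h1
  exact ((hasFTaylorSeriesUpTo_setIntegral hh hS).eq_iteratedFDeriv (natCast_fin_le k) _).symm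

/-- A closed subspace of jets is stable under integration with respect to a parameter. -/
lemma setIntegral_mem_jetComap {K : Set V} [CompactSpace K] {M : Submodule ℝ C(K, Jet m V)}
    (hM : IsClosed (M : Set C(K, Jet m V))) {h : Y → V → ℝ}
    (hh : ContDiff ℝ m (fun p : Y × V => h p.1 p.2)) {S : Set Y} (hS : IsCompact S)
    (hmem : ∀ y, h y ∈ jetComap M) : (fun z => ∫ y in S, h y z ∂μ) ∈ jetComap M := by
  refine ⟨contDiff_setIntegral hh hS, ?_⟩
  rw [jet_setIntegral hh hS]
  have : CompleteSpace M := hM.completeSpace_coe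
  let f : Y → M := fun y => ⟨jet K (h y) (contDiff_of_param hh y), (hmem y).2⟩
  have hf : IntegrableOn f S μ :=
    ((continuous_jet_param hh).subtype_mk _).continuousOn.integrableOn_compact hS
  have := M.subtypeL.integral_comp_comm hf
  exact this ▸ (∫ y in S, f y ∂μ).2

end Parametric

/-! ### Bounded smooth functions with a vanishing derivative -/

/-- A bounded smooth function on the line one of whose derivatives vanishes identically is constant:
otherwise its increments `x ↦ g (x + h) - g x` are constant by induction, and an arithmetic
progression `n ↦ g (n h)` is bounded only if its difference is zero. -/
lemma eq_of_iterate_deriv_eq_zero (k : ℕ) : ∀ g : ℝ → ℝ, ContDiff ℝ (⊤ : ℕ∞) g →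
    (∃ C, ∀ s, |g s| ≤ C) → (∀ s, deriv^[k + 1] g s = 0) → ∀ s t, g s = g t := by
  induction k with
  | zero =>
    intro g hg _ h0 s t
    exact is_const_of_deriv_eq_zero (hg.differentiable (by simp)) h0 s t
  | succ k ih =>
    rintro g hg ⟨C, hC⟩ h0
    have hconst : ∀ h s t, g (s + h) - g s = g (t + h) - g t := by
      intro h
      refine ih (fun s => g (s + h) - g s) ((hg.comp (contDiff_id.add contDiff_const)).sub hg)
        ⟨C + C, fun s => (abs_sub _ _).trans (add_le_add (hC _) (hC _))⟩ fun s => ?_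
      have hD : ContDiff ℝ (⊤ : ℕ∞) (deriv^[k + 1] g) := hg.iterate_deriv (k + 1)
      have hDc := is_const_of_deriv_eq_zero (hD.differentiable (by simp))
        (fun s => by simpa [Function.iterate_succ_apply'] using h0 s)
      rw [← iteratedDeriv_eq_iterate] at hDc ⊢
      have hgh : ContDiff ℝ (⊤ : ℕ∞) fun s => g (s + h) :=
        hg.comp (contDiff_id.add contDiff_const)
      rw [iteratedDeriv_fun_sub (hgh.contDiffAt.of_le (by exact_mod_cast le_top))
        (hg.contDiffAt.of_le (by exact_mod_cast le_top)), iteratedDeriv_comp_add_const]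
      exact sub_eq_zero.2 (hDc (s + h) s)
    have hzero : ∀ h, g h = g 0 := by
      intro h
      have hn : ∀ n : ℕ, g (n * h) = g 0 + n * (g h - g 0) := by
        intro n
        induction n with
        | zero => simp
        | succ n ihn =>
          have := hconst h (n * h) 0
          rw [zero_add] at this
          push_cast
          rw [add_mul, one_mul]
          linarith
      by_contra hne
      have hpos : 0 < |g h - g 0| := abs_pos.2 (sub_ne_zero.2 hne)
      obtain ⟨n, hn'⟩ := exists_nat_gt (2 * C / |g h - g 0|)
      rw [div_lt_iff₀ hpos] at hn'
      have h1 : |(n : ℝ) * (g h - g 0)| ≤ C + C := by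
        have : (n : ℝ) * (g h - g 0) = g (n * h) - g 0 := by rw [hn]; ring
        rw [this]
        exact (abs_sub _ _).trans (add_le_add (hC _) (hC _))
      rw [abs_mul, Nat.abs_cast] at h1
      linarith
    exact fun s t => (hzero s).trans (hzero t).symm

lemma exists_iterate_deriv_ne_zero {g : ℝ → ℝ} (hg : ContDiff ℝ (⊤ : ℕ∞) g)
    (hbdd : ∃ C, ∀ s, |g s| ≤ C) (hne : ∃ s t, g s ≠ g t) (k : ℕ) : ∃ b, deriv^[k] g b ≠ 0 := by
  obtain ⟨s, t, hst⟩ := hne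
  by_contra! h
  cases k with
  | zero => exact hst ((h s).trans (h t).symm)
  | succ k => exact hst (eq_of_iterate_deriv_eq_zero k g hg hbdd h s t)

/-- Mollification of a bounded non-constant continuous function produces a bounded non-constant
smooth function. -/
lemma exists_mollification {σ : ℝ → ℝ} (hσ : Continuous σ) (hσ_bdd : ∃ C, ∀ s, |σ s| ≤ C)
    (hne : ∃ s t, σ s ≠ σ t) :
    ∃ φ : ℝ → ℝ, ContDiff ℝ (⊤ : ℕ∞) φ ∧ HasCompactSupport φ ∧
      ContDiff ℝ (⊤ : ℕ∞) (fun s => ∫ y, φ y * σ (s - y)) ∧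
      (∃ C, ∀ s, |∫ y, φ y * σ (s - y)| ≤ C) ∧
      ∃ s t, ∫ y, φ y * σ (s - y) ≠ ∫ y, φ y * σ (t - y) := by
  obtain ⟨C, hC⟩ := hσ_bdd
  obtain ⟨s, t, hst⟩ := hne
  let φ : ℕ → ContDiffBump (0 : ℝ) := fun n =>
    ⟨1 / (2 * ((n : ℝ) + 1)), 1 / ((n : ℝ) + 1), by positivity, by
      rw [div_lt_div_iff₀ (by positivity) (by positivity)]; nlinarith⟩
  have hφ : Tendsto (fun n => (φ n).rOut) atTop (𝓝 0) := tendsto_one_div_add_atTop_nhds_zero_nat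
  have hs := ContDiffBump.convolution_tendsto_right_of_continuous
    (μ := MeasureTheory.volume) hφ hσ s
  have ht := ContDiffBump.convolution_tendsto_right_of_continuous
    (μ := MeasureTheory.volume) hφ hσ t
  have hev := (hs.sub ht).eventually_ne (sub_ne_zero.2 hst)
  obtain ⟨n, hn⟩ := hev.exists
  refine ⟨(φ n).normed MeasureTheory.volume, (φ n).contDiff_normed, (φ n).hasCompactSupport_normed,
    ?_, ?_, s, t, sub_ne_zero.1 hn⟩
  · exact (φ n).hasCompactSupport_normed.contDiff_convolution_left
      (ContinuousLinearMap.lsmul ℝ ℝ) (φ n).contDiff_normed hσ.locallyIntegrable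
  · refine ⟨C, fun x => ?_⟩
    have h1 : MeasureTheory.Integrable (fun y => (φ n).normed MeasureTheory.volume y * C) :=
      (φ n).integrable_normed.mul_const C
    have h2 := MeasureTheory.norm_integral_le_of_norm_le
      (f := fun y => (φ n).normed MeasureTheory.volume y * σ (x - y)) h1
      (Eventually.of_forall fun y => by
        rw [norm_mul, Real.norm_of_nonneg ((φ n).nonneg_normed y)]
        exact mul_le_mul_of_nonneg_left (hC _) ((φ n).nonneg_normed y))
    rwa [MeasureTheory.integral_mul_const, (φ n).integral_normed, one_mul] at h2

/-! ### Closed subspaces of jets containing ridge functions -/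

section Ridge

open MeasureTheory

variable {m : ℕ} {V : Type*} [NormedAddCommGroup V] [NormedSpace ℝ V] [FiniteDimensional ℝ V]
  {K : Set V} [CompactSpace K] {M : Submodule ℝ C(K, Jet m V)}

/-- A closed subspace containing a curve of functions contains its derivative: the increments of
the curve are integrals of its derivative, and the curve of jets of the derivative is continuous. -/
lemma deriv_param_mem_jetComap (hM : IsClosed (M : Set C(K, Jet m V))) {h h' : ℝ → V → ℝ}
    (hh' : ContDiff ℝ m (fun p : ℝ × V => h' p.1 p.2))
    (hd : ∀ a z, HasDerivAt (fun a => h a z) (h' a z) a) (hmem : ∀ a, h a ∈ jetComap M) :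
    h' 0 ∈ jetComap M := by
  refine ⟨contDiff_of_param hh' 0, ?_⟩
  have hJ := continuous_jet_param (K := K) hh'
  have hder := (intervalIntegral.integral_hasDerivAt_right (hJ.intervalIntegrable 0 0)
    (hJ.stronglyMeasurableAtFilter _ _) hJ.continuousAt).tendsto_slope_zero_right
  refine hM.mem_of_tendsto hder ?_
  filter_upwards [self_mem_nhdsWithin] with t ht
  refine M.smul_mem _ ?_
  obtain ⟨hF, hF'⟩ := (jetComap M).sub_mem (hmem t) (hmem 0)
  have ht0 : (0 : ℝ) ≤ t := le_of_lt ht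
  have heq : h t - h 0 = fun z => ∫ a in Icc 0 t, h' a z := by
    ext z
    rw [integral_Icc_eq_integral_Ioc, ← intervalIntegral.integral_of_le ht0,
      intervalIntegral.integral_eq_sub_of_hasDerivAt (fun a _ => hd a z)]
    · rfl
    · exact (hh'.continuous.comp (continuous_id.prodMk continuous_const)).intervalIntegrable 0 t
  have hjet : jet K (h t - h 0) hF = ∫ a in (0 : ℝ)..t, jet K (h' a) (contDiff_of_param hh' a) := by
    rw [intervalIntegral.integral_of_le ht0, ← integral_Icc_eq_integral_Ioc,
      ← jet_setIntegral hh' isCompact_Icc]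
    congr 1
  simpa [hjet] using hF'

/-- The algebra of polynomial functions on `V`, generated by the linear forms. -/
def polyFunctions (V : Type*) [NormedAddCommGroup V] [NormedSpace ℝ V] :
    Subalgebra ℝ (V → ℝ) :=
  Algebra.adjoin ℝ (range fun l : V →L[ℝ] ℝ => (l : V → ℝ))

lemma linearForm_mem_polyFunctions {W : Type*} [NormedAddCommGroup W] [NormedSpace ℝ W]
    (l : W →L[ℝ] ℝ) : (l : W → ℝ) ∈ polyFunctions W :=
  Algebra.subset_adjoin ⟨l, rfl⟩

/-- If a closed subspace contains all functions `g (l z + b)`, with `g` smooth and no derivative of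
`g` vanishing identically, it contains all polynomials: differentiating `k` times in the direction
of linear forms `l₁, …, lₖ` gives `l₁ ⋯ lₖ g⁽ᵏ⁾(l z + b)`, and then `l = 0` is allowed. -/
lemma polyFunctions_le_jetComap (hM : IsClosed (M : Set C(K, Jet m V))) {g : ℝ → ℝ}
    (hg : ContDiff ℝ (⊤ : ℕ∞) g) (hne : ∀ k : ℕ, ∃ b, deriv^[k] g b ≠ 0)
    (hmem : ∀ (l : V →L[ℝ] ℝ) (b : ℝ), (fun z => g (l z + b)) ∈ jetComap M) :
    Subalgebra.toSubmodule (polyFunctions V) ≤ jetComap M := by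
  rw [polyFunctions, Algebra.adjoin_eq_span, Submodule.span_le]
  have key : ∀ p ∈ Submonoid.closure (range fun l : V →L[ℝ] ℝ => (l : V → ℝ)),
      ContDiff ℝ (⊤ : ℕ∞) p ∧ ∃ k : ℕ, ∀ (l : V →L[ℝ] ℝ) (b : ℝ),
        (fun z => p z * deriv^[k] g (l z + b)) ∈ jetComap M := by
    intro p hp
    induction hp using Submonoid.closure_induction_left with
    | one => exact ⟨contDiff_const, 0, fun l b => by simpa using hmem l b⟩
    | mul_left x hx p hp ih =>
      obtain ⟨x, rfl⟩ := hx
      obtain ⟨hpc, k, hk⟩ := ih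
      refine ⟨x.contDiff.mul hpc, k + 1, fun l b => ?_⟩
      have hgk : ContDiff ℝ (⊤ : ℕ∞) (deriv^[k + 1] g) := hg.iterate_deriv (k + 1)
      have hgk' : ∀ s, HasDerivAt (deriv^[k] g) (deriv^[k + 1] g s) s := fun s => by
        rw [Function.iterate_succ_apply']
        exact ((hg.iterate_deriv k).differentiable (by simp) s).hasDerivAt
      have := deriv_param_mem_jetComap hM
        (h := fun a z => p z * deriv^[k] g ((l + a • x) z + b))
        (h' := fun a z => x z * p z * deriv^[k + 1] g ((l + a • x) z + b)) ?_ ?_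
        (fun a => hk (l + a • x) b)
      · simpa using this
      · have h1 : ContDiff ℝ (⊤ : ℕ∞) (fun q : ℝ × V =>
            x q.2 * p q.2 * deriv^[k + 1] g ((l q.2 + q.1 * x q.2) + b)) := by
          have hx2 : ContDiff ℝ (⊤ : ℕ∞) (fun q : ℝ × V => x q.2) := x.contDiff.comp contDiff_snd
          have hl2 : ContDiff ℝ (⊤ : ℕ∞) (fun q : ℝ × V => l q.2) := l.contDiff.comp contDiff_snd
          exact (hx2.mul (hpc.comp contDiff_snd)).mul
            (hgk.comp ((hl2.add (contDiff_fst.mul hx2)).add contDiff_const))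
        simpa using h1.of_le (by exact_mod_cast le_top)
      · intro a z
        have h1 : HasDerivAt (fun a : ℝ => (l + a • x) z + b) (x z) a := by
          simpa using ((hasDerivAt_id a).mul_const (x z)).const_add (l z) |>.add_const b
        have h2 := ((hgk' ((l + a • x) z + b)).comp a h1).const_mul (p z)
        refine h2.congr_deriv ?_
        ring
  intro p hp
  obtain ⟨-, k, hk⟩ := key p hp
  obtain ⟨b, hb⟩ := hne k
  have := (jetComap M).smul_mem (deriv^[k] g b)⁻¹ (hk 0 b)
  have hp' : p = (deriv^[k] g b)⁻¹ • fun z => p z * deriv^[k] g ((0 : V →L[ℝ] ℝ) z + b) := by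
    ext z
    simp [mul_comm (p z), hb]
  exact hp' ▸ this

/-- A closed subspace of jets containing all polynomials contains all compactly supported `C^m`
functions: these are limits of their convolutions with the normalized powers of a
quadratic polynomial which is positive with a strict maximum at `0` on a large ball, and such
convolutions agree near `K` with integrals of polynomials. -/
lemma mem_jetComap_of_hasCompactSupport (hM : IsClosed (M : Set C(K, Jet m V)))
    (hpoly : Subalgebra.toSubmodule (polyFunctions V) ≤ jetComap M) {F : V → ℝ}
    (hF : ContDiff ℝ m F) (hFs : HasCompactSupport F) : F ∈ jetComap M := by
  let : MeasurableSpace V := borel V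
  have : BorelSpace V := ⟨rfl⟩
  let μ : Measure V := Measure.addHaar
  obtain ⟨R, hR0, hR⟩ : ∃ R : ℝ, 0 < R ∧ K ∪ tsupport F ⊆ Metric.closedBall 0 R :=
    ((isCompact_iff_compactSpace.2 ‹_›).union hFs).isBounded.subset_closedBall_lt 0 0
  have hFR : ∀ y ∉ Metric.closedBall (0 : V) R, F y = 0 := fun y hy =>
    image_eq_zero_of_notMem_tsupport fun h => hy (hR (Or.inr h))
  -- For `z` in the ball of radius `R + 1`, a neighbourhood of `K`, the function `y ↦ F (z - y)` is
  -- supported in `S`, so that integrating it over `S` amounts to integrating over the whole space.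
  let S := Metric.closedBall (0 : V) (2 * R + 1)
  have hS : IsCompact S := isCompact_closedBall _ _
  let e := Module.finBasis ℝ V
  let l : Fin (Module.finrank ℝ V) → V →L[ℝ] ℝ := fun i => (e.coord i).toContinuousLinearMap
  let q : V → ℝ := fun y => ∑ i, l i y ^ 2
  have hq : ContDiff ℝ m q := ContDiff.sum fun i _ => (l i).contDiff.pow 2
  have hq0 : ∀ y, y ≠ 0 → 0 < q y := by
    intro y hy
    refine (Finset.sum_nonneg fun i _ => sq_nonneg (l i y)).lt_of_ne' fun h => hy ?_
    rw [Finset.sum_eq_zero_iff_of_nonneg fun i _ => sq_nonneg _] at h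
    refine e.ext_elem fun i => ?_
    simpa [l] using h i (Finset.mem_univ i)
  obtain ⟨A, hA⟩ := hS.exists_bound_of_continuousOn hq.continuous.continuousOn
  have hA0 : 0 ≤ A := (norm_nonneg _).trans (hA 0 (by simp [S]; positivity))
  -- The peak: at least `1` on `S`, with its maximum at the origin only.
  let c : V → ℝ := fun y => A + 1 - q y
  have hc : ContDiff ℝ m c := contDiff_const.sub hq
  have hq00 : q 0 = 0 := by simp [q]
  have hjoint : ContDiff ℝ m fun p : V × V => F (p.2 - p.1) :=
    hF.comp (contDiff_snd.sub contDiff_fst)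
  have hpeak := tendsto_setIntegral_pow_smul_of_unique_maximum_of_isCompact_of_continuousOn
    (μ := μ) (x₀ := (0 : V)) hS hc.continuous.continuousOn
    (fun y _ hy => by simpa [c, hq00] using hq0 y hy)
    (fun y hy => by have := (le_abs_self _).trans (hA y hy); simp only [c]; linarith)
    (by simp only [c, hq00]; linarith)
    (subset_closure (mem_interior_iff_mem_nhds.2 (Metric.closedBall_mem_nhds _ (by positivity))))
    (continuous_jet_param (K := K) (h := fun y z => F (z - y)) hjoint).continuousOn
  refine ⟨hF, ?_⟩
  have hF0 : jet K F hF = jet K (fun z => F (z - 0)) (contDiff_of_param (h := fun y z => F (z - y)) hjoint 0) := by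
    congr 1; simp
  rw [hF0]
  refine hM.mem_of_tendsto hpeak (Eventually.of_forall fun n => M.smul_mem _ ?_)
  have hjoint' : ContDiff ℝ m fun p : V × V => c p.1 ^ n * F (p.2 - p.1) :=
    ((hc.comp contDiff_fst).pow n).mul hjoint
  have hjoint'' : ContDiff ℝ m fun p : V × V => F p.1 * c (p.2 - p.1) ^ n :=
    (hF.comp contDiff_fst).mul ((hc.comp (contDiff_snd.sub contDiff_fst)).pow n)
  have h1 : (∫ y in S, c y ^ n • jet K (fun z => F (z - y)) (contDiff_of_param (h := fun y z => F (z - y)) hjoint y) ∂μ) =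
      jet K (fun z => ∫ y in S, c y ^ n * F (z - y) ∂μ) (contDiff_setIntegral (h := fun y z => c y ^ n * F (z - y)) hjoint' hS) := by
    rw [jet_setIntegral hjoint' hS]
    congr 1
    ext1 y
    exact (jet_smul (contDiff_of_param (h := fun y z => F (z - y)) hjoint y) (c y ^ n)).symm
  rw [h1]
  have hG : (fun z => ∫ y in Metric.closedBall (0 : V) R, F y * c (z - y) ^ n ∂μ) ∈ jetComap M := by
    refine setIntegral_mem_jetComap hM hjoint'' (isCompact_closedBall _ _) fun y => ?_
    refine (jetComap M).smul_mem (F y) (hpoly ?_)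
    change (fun z => c (z - y) ^ n) ∈ polyFunctions V
    refine (polyFunctions V).pow_mem (x := fun z => c (z - y)) ?_ n
    have hconst : ∀ r : ℝ, (fun _ : V => r) ∈ polyFunctions V := fun r =>
      (polyFunctions V).algebraMap_mem r
    refine sub_mem (hconst _) ?_
    have hsum : (fun z => q (z - y)) = ∑ i, ((l i : V → ℝ) - fun _ => l i y) ^ 2 := by
      ext z
      simp [q]
    rw [hsum]
    exact sum_mem fun i _ =>
      pow_mem (sub_mem (linearForm_mem_polyFunctions (l i)) (hconst _)) 2
  refine (mem_jetComap_congr (U := Metric.ball 0 (R + 1)) Metric.isOpen_ball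
    (fun z hz => Metric.closedBall_subset_ball (by linarith) (hR (Or.inl hz)))
    (contDiff_setIntegral (h := fun y z => c y ^ n * F (z - y)) hjoint' hS) hG fun z hz => ?_).2
  calc ∫ y in S, c y ^ n * F (z - y) ∂μ
      = ∫ y, c y ^ n * F (z - y) ∂μ := by
        refine setIntegral_eq_integral_of_forall_compl_eq_zero fun y hy => ?_
        rw [hFR (z - y), mul_zero]
        simp only [S, Metric.mem_closedBall, Metric.mem_ball, dist_zero_right, not_le] at hy hz ⊢
        have := norm_sub_norm_le y z
        rw [norm_sub_rev] at this
        linarith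
    _ = ∫ y, F y * c (z - y) ^ n ∂μ := by
        rw [← integral_sub_left_eq_self _ μ z]
        simp [mul_comm]
    _ = ∫ y in Metric.closedBall (0 : V) R, F y * c (z - y) ^ n ∂μ := by
        refine (setIntegral_eq_integral_of_forall_compl_eq_zero fun y hy => ?_).symm
        rw [hFR y hy, zero_mul]

/-- For a bounded non-constant `C^m` function `σ`, a closed subspace of jets along a compact set
which contains all the ridge functions `σ (l z + b)` contains all `C^m` functions. -/
theorem mem_jetComap_of_ridge (hM : IsClosed (M : Set C(K, Jet m V))) {σ : ℝ → ℝ}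
    (hσ : ContDiff ℝ m σ) (hσ_bdd : ∃ C, ∀ s, |σ s| ≤ C) (hne : ∃ s t, σ s ≠ σ t)
    (hmem : ∀ (l : V →L[ℝ] ℝ) (b : ℝ), (fun z => σ (l z + b)) ∈ jetComap M)
    {F : V → ℝ} (hF : ContDiff ℝ m F) : F ∈ jetComap M := by
  obtain ⟨φ, hφ, hφs, hg, hg_bdd, hg_ne⟩ := exists_mollification hσ.continuous hσ_bdd hne
  have hpoly := polyFunctions_le_jetComap hM hg
    (exists_iterate_deriv_ne_zero hg hg_bdd hg_ne) fun l b => by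
      have hjoint : ContDiff ℝ m fun p : ℝ × V => φ p.1 * σ (l p.2 + b - p.1) :=
        ((hφ.of_le (by exact_mod_cast le_top)).comp contDiff_fst).mul
          (hσ.comp (((l.contDiff.comp contDiff_snd).add contDiff_const).sub contDiff_fst))
      have := setIntegral_mem_jetComap (μ := volume) hM hjoint hφs fun y => by
        have := (jetComap M).smul_mem (φ y) (hmem l (b - y))
        simpa only [Pi.smul_def, smul_eq_mul, ← add_sub_assoc] using this
      convert this using 2 with z
      refine (setIntegral_eq_integral_of_forall_compl_eq_zero fun y hy => ?_).symm
      rw [image_eq_zero_of_notMem_tsupport hy, zero_mul]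
  obtain ⟨R, hR0, hR⟩ : ∃ R : ℝ, 0 < R ∧ K ⊆ Metric.closedBall 0 R :=
    (isCompact_iff_compactSpace.2 ‹CompactSpace K›).isBounded.subset_closedBall_lt 0 0
  let χ : ContDiffBump (0 : V) := ⟨R + 1, R + 2, by linarith, by linarith⟩
  refine mem_jetComap_congr (U := Metric.ball 0 (R + 1)) Metric.isOpen_ball
    (fun z hz => Metric.closedBall_subset_ball (by linarith) (hR hz)) hF
    (mem_jetComap_of_hasCompactSupport hM hpoly (χ.contDiff.mul hF)
      (χ.hasCompactSupport.mul_right)) fun z hz => ?_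
  rw [χ.one_of_mem_closedBall (Metric.ball_subset_closedBall hz), one_mul]

end Ridge

/-! ### Jets of compositions -/

section Composition

/-- Each coefficient of the composition of two formal multilinear series depends continuously on the
coefficients of the same or lower degree of the two series. -/
lemma continuous_taylorComp {X E F G : Type*} [TopologicalSpace X]
    [NormedAddCommGroup E] [NormedSpace ℝ E] [NormedAddCommGroup F] [NormedSpace ℝ F]
    [NormedAddCommGroup G] [NormedSpace ℝ G] {q : X → FormalMultilinearSeries ℝ F G}
    {p : X → FormalMultilinearSeries ℝ E F} {k : ℕ} (hq : ∀ i ≤ k, Continuous fun x => q x i)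
    (hp : ∀ i ≤ k, Continuous fun x => p x i) :
    Continuous fun x => (q x).taylorComp (p x) k := by
  refine continuous_finsetSum _ fun c _ => ?_
  have h1 : Continuous fun x => c.compAlongOrderedFinpartitionL ℝ E F G (q x c.length) :=
    (ContinuousLinearMap.continuous _).comp (hq _ c.length_le)
  have h2 : Continuous fun x => fun i => p x (c.partSize i) :=
    continuous_pi fun i => hp _ (c.partSize_le i)
  exact h1.eval h2

variable {m : ℕ} {V : Type*} [NormedAddCommGroup V] [NormedSpace ℝ V]

/-- The formal multilinear series whose coefficients of degree at most `m` are those of a jet, the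
other ones being zero. -/
noncomputable def Jet.toSeries (p : Jet m V) : FormalMultilinearSeries ℝ V ℝ := fun i =>
  if h : i < m + 1 then Jet.coeff ⟨i, h⟩ p else 0

lemma Jet.continuous_toSeries {i : ℕ} : Continuous fun p : Jet m V => p.toSeries i := by
  by_cases h : i < m + 1
  · simp only [Jet.toSeries, h, dif_pos]
    exact (Jet.coeff _).continuous
  · simp only [Jet.toSeries, h, dif_neg, not_false_iff]
    exact continuous_const

/-- The action of a scalar function `σ` on jets: the jet of `σ ∘ g` at a point is the image of the
jet of `g` there. -/
noncomputable def Jet.postcomp (σ : ℝ → ℝ) (p : Jet m V) : Jet m V := fun k =>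
  (ftaylorSeries ℝ σ (Jet.coeff 0 p 0)).taylorComp p.toSeries k

lemma Jet.continuous_postcomp {σ : ℝ → ℝ} (hσ : ContDiff ℝ m σ) :
    Continuous (Jet.postcomp σ : Jet m V → Jet m V) := by
  refine Jet.continuous_of_coeff fun k => ?_
  refine continuous_taylorComp (q := fun p : Jet m V => ftaylorSeries ℝ σ (Jet.coeff 0 p 0))
    (p := fun p : Jet m V => p.toSeries) (fun i hi => ?_) fun i hi => ?_
  · have h0 : Continuous fun p : Jet m V => Jet.coeff 0 p (0 : Fin ((0 : Fin (m + 1)) : ℕ) → V) :=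
      (ContinuousMultilinearMap.apply ℝ (fun _ : Fin ((0 : Fin (m + 1)) : ℕ) => V) ℝ 0).continuous.comp
        (Jet.coeff (m := m) (V := V) 0).continuous
    exact (hσ.continuous_iteratedFDeriv (by exact_mod_cast hi.trans (Nat.lt_succ_iff.1 k.2))).comp h0
  · exact Jet.continuous_toSeries

lemma jet_comp {K : Set V} {σ : ℝ → ℝ} (hσ : ContDiff ℝ m σ) {g : V → ℝ} (hg : ContDiff ℝ m g)
    (z : K) : jet K (σ ∘ g) (hσ.comp hg) z = Jet.postcomp σ (jet K g hg z) := by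
  refine Jet.ext fun k => ?_
  have h1 : iteratedFDeriv ℝ (k : ℕ) (σ ∘ g) (z : V) =
      (ftaylorSeries ℝ σ (g z)).taylorComp (ftaylorSeries ℝ g z) k :=
    iteratedFDeriv_comp hσ.contDiffAt hg.contDiffAt (natCast_fin_le k)
  refine h1.trans ?_
  refine Finset.sum_congr rfl fun c _ => ?_
  unfold FormalMultilinearSeries.compAlongOrderedFinpartition
  have h2 : ∀ i, (jet K g hg z).toSeries (c.partSize i) = ftaylorSeries ℝ g z (c.partSize i) := by
    intro i
    have : c.partSize i < m + 1 := lt_of_le_of_lt (c.partSize_le i) k.2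
    simp only [Jet.toSeries, this, dif_pos]
    rfl
  simp_rw [h2]
  rfl

/-- The subspace of the jets along `K` of the `C^m` functions in `N`. -/
noncomputable def jetMap (m : ℕ) (K : Set V) (N : Submodule ℝ (V → ℝ)) :
    Submodule ℝ C(K, Jet m V) where
  carrier := {P | ∃ F ∈ N, ∃ hF : ContDiff ℝ m F, jet K F hF = P}
  zero_mem' := ⟨0, N.zero_mem, contDiff_const, by
    have h0 : ContDiff ℝ m (0 : V → ℝ) := contDiff_const
    have : jet K (0 : V → ℝ) h0 = (0 : ℝ) • jet K (0 : V → ℝ) h0 := by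
      rw [← jet_smul]; congr 1; simp
    rw [this, zero_smul]⟩
  add_mem' := by
    rintro _ _ ⟨F, hFN, hF, rfl⟩ ⟨G, hGN, hG, rfl⟩
    exact ⟨F + G, N.add_mem hFN hGN, hF.add hG, jet_add hF hG⟩
  smul_mem' := by
    rintro a _ ⟨F, hFN, hF, rfl⟩
    exact ⟨a • F, N.smul_mem a hFN, hF.const_smul a, jet_smul hF a⟩

/-- If the functions `σ ∘ g` with `g ∈ N` lie in `N'`, then composition with `σ` maps `m`-limits of
members of `N` to `m`-limits of members of `N'`. -/
lemma comp_mem_jetComap_closure {K : Set V} [CompactSpace K] {σ : ℝ → ℝ} (hσ : ContDiff ℝ m σ)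
    {N N' : Submodule ℝ (V → ℝ)} (hNN' : ∀ g ∈ N, σ ∘ g ∈ N') {g : V → ℝ}
    (hg : g ∈ jetComap (jetMap m K N).topologicalClosure) :
    σ ∘ g ∈ jetComap (jetMap m K N').topologicalClosure := by
  obtain ⟨hgc, hg⟩ := hg
  refine ⟨hσ.comp hgc, ?_⟩
  let Φ : C(K, Jet m V) → C(K, Jet m V) := fun P =>
    (⟨Jet.postcomp σ, Jet.continuous_postcomp hσ⟩ : C(Jet m V, Jet m V)).comp P
  have hΦ : Continuous Φ := ContinuousMap.continuous_postcomp _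
  have hjet : ∀ (f : V → ℝ) (hf : ContDiff ℝ m f), jet K (σ ∘ f) (hσ.comp hf) = Φ (jet K f hf) :=
    fun f hf => ContinuousMap.ext fun z => jet_comp hσ hf z
  rw [hjet g hgc]
  refine map_mem_closure (t := (jetMap m K N' : Set C(K, Jet m V))) hΦ hg ?_
  rintro _ ⟨f, hfN, hf, rfl⟩
  exact ⟨σ ∘ f, hNN' f hfN, hσ.comp hf, hjet f hf⟩

end Composition

/-! ### Deep networks -/

section Networks

variable {d : ℕ} {σ : ℝ → ℝ}

lemma IsLayerInput.one_le {l n : ℕ} {y : SpaceTime d → Fin n → ℝ} (h : IsLayerInput d σ l n y) :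
    1 ≤ l := by
  cases h <;> omega

/-- Two layer inputs of the same depth can be put side by side, with block diagonal weights. -/
lemma IsLayerInput.append {l n : ℕ} {y : SpaceTime d → Fin n → ℝ} (h : IsLayerInput d σ l n y) :
    ∀ {n' : ℕ} {y' : SpaceTime d → Fin n' → ℝ}, IsLayerInput d σ l n' y' →
      IsLayerInput d σ l (n + n') (fun z => Fin.append (y z) (y' z)) := by
  induction h with
  | @first n hn w v b =>
    intro n' y' h'
    cases h' with
    | first hn' w' v' b' =>
      convert IsLayerInput.first (d := d) (σ := σ) (n := n + n') (by omega)
        (Fin.append w w') (Fin.append v v') (Fin.append b b') using 3 with z i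
      refine Fin.addCases (fun i => ?_) (fun i => ?_) i
      · rw [Fin.append_left w w' i]; simp
      · rw [Fin.append_right w w' i]; simp
    | next hy => exact absurd hy.one_le (by omega)
  | @next l n₀ n y hy hn w b ih =>
    intro n' y' h'
    cases h' with
    | first => exact absurd hy.one_le (by omega)
    | @next _ n₁ _ y₁ hy₁ hn' w' b' =>
      convert IsLayerInput.next (n' := n + n') (ih hy₁) (by omega)
        (Fin.append (fun i => Fin.append (w i) 0) (fun i => Fin.append 0 (w' i)))
        (Fin.append b b') using 3 with z i
      refine Fin.addCases (fun i => ?_) (fun i => ?_) i <;> simp [Fin.sum_univ_add]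

lemma IsLayerInput.contDiff {m : ℕ} (hσ : ContDiff ℝ m σ) {l n : ℕ} {y : SpaceTime d → Fin n → ℝ}
    (h : IsLayerInput d σ l n y) (i : Fin n) : ContDiff ℝ m fun z => y z i := by
  induction h with
  | first hn w v b => fun_prop
  | next hy hn w b ih =>
    exact (ContDiff.sum fun k _ => contDiff_const.mul (hσ.comp (ih k))).add contDiff_const

lemma contDiff_of_mem_deepNetworks {m L : ℕ} (hσ : ContDiff ℝ m σ) {ξ : SpaceTime d → ℝ}
    (hξ : ξ ∈ deepNetworks d L σ) : ContDiff ℝ m ξ := by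
  obtain ⟨n, y, c, hy, rfl⟩ := hξ
  exact ContDiff.sum fun i _ => contDiff_const.mul (hσ.comp (hy.contDiff hσ i))

lemma exists_isLayerInput (d : ℕ) (σ : ℝ → ℝ) (L : ℕ) :
    ∃ y, IsLayerInput d σ (L + 1) 1 y := by
  induction L with
  | zero => exact ⟨_, .first one_pos 0 0 0⟩
  | succ L ih => exact ⟨_, .next ih.choose_spec one_pos 0 0⟩

/-- The scalar networks with `L + 1` hidden layers form a vector space. -/
def networkSpace (d L : ℕ) (σ : ℝ → ℝ) : Submodule ℝ (SpaceTime d → ℝ) where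
  carrier := deepNetworks d (L + 1) σ
  zero_mem' := by
    obtain ⟨y, hy⟩ := exists_isLayerInput d σ L
    exact ⟨1, y, 0, hy, by ext; simp⟩
  add_mem' := by
    rintro _ _ ⟨n, y, c, hy, rfl⟩ ⟨n', y', c', hy', rfl⟩
    exact ⟨n + n', _, Fin.append c c', hy.append hy', by ext; simp [Fin.sum_univ_add]⟩
  smul_mem' := by
    rintro a _ ⟨n, y, c, hy, rfl⟩
    exact ⟨n, y, a • c, hy, by ext; simp [Finset.mul_sum, mul_assoc]⟩

lemma ridge_mem_networkSpace (l : SpaceTime d →L[ℝ] ℝ) (b : ℝ) :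
    (fun z => σ (l z + b)) ∈ networkSpace d 0 σ := by
  refine ⟨1, _, fun _ => 1, .first one_pos (fun _ k => l (EuclideanSpace.single k 1, 0))
    (fun _ => l (0, 1)) (fun _ => b), ?_⟩
  ext z
  have hz : z = ∑ k, z.1 k • ((EuclideanSpace.single k 1, 0) : SpaceTime d) +
      z.2 • ((0, 1) : SpaceTime d) := by
    refine Prod.ext ?_ ?_
    · ext i
      simp [Prod.fst_sum, Pi.single_apply]
    · simp [Prod.snd_sum]
  conv_lhs => rw [hz]
  simp only [map_add, map_sum, map_smul, smul_eq_mul, mul_comm, one_mul, Finset.univ_unique,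
    Finset.sum_singleton]

lemma comp_mem_networkSpace {L : ℕ} (b : ℝ) {g : SpaceTime d → ℝ} (hg : g ∈ networkSpace d L σ) :
    (fun s => σ (s + b)) ∘ g ∈ networkSpace d (L + 1) σ := by
  obtain ⟨n, y, c, hy, rfl⟩ := hg
  -- The output of the network becomes the input of a new last layer consisting of one unit.
  refine ⟨1, _, fun _ => 1, .next hy one_pos (fun _ k => c k) (fun _ => b), ?_⟩
  ext z
  simp

/-- Networks of any depth are `m`-dense among the `C^m` functions on a compact set. In the induction
on the depth, a linear form is an `m`-limit of networks with one layer fewer, so that composing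
with `σ` produces the ridge functions. -/
theorem mem_jetComap_networkSpace {m : ℕ} {K : Set (SpaceTime d)} [CompactSpace K]
    (hσ : ContDiff ℝ m σ) (hσ_bdd : ∃ C, ∀ s, |σ s| ≤ C) (hne : ∃ s t, σ s ≠ σ t) (L : ℕ) :
    ∀ {F : SpaceTime d → ℝ}, ContDiff ℝ m F →
      F ∈ jetComap (jetMap m K (networkSpace d L σ)).topologicalClosure := by
  induction L with
  | zero =>
    intro F hF
    refine mem_jetComap_of_ridge (Submodule.isClosed_topologicalClosure _) hσ hσ_bdd hne
      (fun l b => ?_) hF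
    have h1 := ridge_mem_networkSpace (σ := σ) l b
    have h2 : ContDiff ℝ m fun z => σ (l z + b) := contDiff_of_mem_deepNetworks hσ h1
    exact ⟨h2, Submodule.le_topologicalClosure _ ⟨_, h1, h2, rfl⟩⟩
  | succ L ih =>
    intro F hF
    refine mem_jetComap_of_ridge (Submodule.isClosed_topologicalClosure _) hσ hσ_bdd hne
      (fun l b => ?_) hF
    exact comp_mem_jetComap_closure (hσ.comp (contDiff_id.add contDiff_const))
      (fun g hg => comp_mem_networkSpace b hg) (ih l.contDiff)

end Networks

/-! ### Pushing a domain into itself -/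

section Inward

variable {V : Type*} [NormedAddCommGroup V] [NormedSpace ℝ V]

/-- The segment property: near each point of its closure, `U` has a direction `v` (zero is allowed
at interior points) such that moving by `s v`, `0 < s ≤ 1`, maps the closure of `U` into `U`. -/
def HasSegmentProperty (U : Set V) : Prop :=
  ∀ p ∈ closure U, ∃ r : ℝ, 0 < r ∧ ∃ v : V, ∀ z ∈ closure U, z ∈ Metric.ball p r →
    ∀ s ∈ Ioc (0 : ℝ) 1, z + s • v ∈ U

lemma hasSegmentProperty_local_of_mem {U : Set V} (hU : IsOpen U) {p : V} (hp : p ∈ U) :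
    ∃ r : ℝ, 0 < r ∧ ∃ v : V, ∀ z ∈ closure U, z ∈ Metric.ball p r →
      ∀ s ∈ Ioc (0 : ℝ) 1, z + s • v ∈ U := by
  obtain ⟨r, hr, hrU⟩ := Metric.isOpen_iff.1 hU p hp
  exact ⟨r, hr, 0, fun z _ hz s _ => by simpa using hrU hz⟩

lemma HasSegmentProperty.prod {W : Type*} [NormedAddCommGroup W] [NormedSpace ℝ W]
    {U : Set V} {U' : Set W} (h : HasSegmentProperty U) (h' : HasSegmentProperty U') :
    HasSegmentProperty (U ×ˢ U') := by
  rintro ⟨p, p'⟩ hp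
  rw [closure_prod_eq] at hp ⊢
  obtain ⟨r, hr, v, hv⟩ := h p hp.1
  obtain ⟨r', hr', v', hv'⟩ := h' p' hp.2
  refine ⟨min r r', lt_min hr hr', (v, v'), ?_⟩
  rintro ⟨z, z'⟩ hz hzb s hs
  rw [Metric.mem_ball, Prod.dist_eq, max_lt_iff] at hzb
  exact ⟨hv z hz.1 (hzb.1.trans_le (min_le_left _ _)) s hs,
    hv' z' hz.2 (hzb.2.trans_le (min_le_right _ _)) s hs⟩

lemma hasSegmentProperty_Ioo {T : ℝ} (hT : 0 < T) : HasSegmentProperty (Ioo 0 T) := by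
  intro p hp
  by_cases hpU : p ∈ Ioo 0 T
  · exact hasSegmentProperty_local_of_mem isOpen_Ioo hpU
  rw [closure_Ioo hT.ne] at hp ⊢
  have hp' : p = 0 ∨ p = T := by
    by_contra! h
    exact hpU ⟨lt_of_le_of_ne hp.1 h.1.symm, lt_of_le_of_ne hp.2 h.2⟩
  rcases hp' with rfl | rfl
  · refine ⟨T / 2, by positivity, T / 2, fun z hz hzb s hs => ?_⟩
    rw [Metric.mem_ball, dist_zero_right, Real.norm_eq_abs, abs_lt] at hzb
    have h1 : 0 < s * (T / 2) := mul_pos hs.1 (by positivity)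
    have h2 : s * (T / 2) ≤ 1 * (T / 2) := mul_le_mul_of_nonneg_right hs.2 (by positivity)
    simp only [smul_eq_mul, mem_Ioo]
    constructor <;> linarith [hz.1, hzb.2]
  · refine ⟨p / 2, by positivity, -(p / 2), fun z hz hzb s hs => ?_⟩
    rw [Metric.mem_ball, Real.dist_eq, abs_lt] at hzb
    have h1 : 0 < s * (p / 2) := mul_pos hs.1 (by positivity)
    have h2 : s * (p / 2) ≤ 1 * (p / 2) := mul_le_mul_of_nonneg_right hs.2 (by positivity)
    simp only [smul_eq_mul, mem_Ioo, mul_neg]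
    constructor <;> linarith [hz.2, hzb.1]

/-- A domain with continuous boundary has the segment property, with the vertical direction of the
graph at a boundary point. -/
lemma HasContinuousBoundary.hasSegmentProperty {d : ℕ} {Ω : Set (EuclideanSpace ℝ (Fin d))}
    (hΩ : IsOpen Ω) (h : HasContinuousBoundary Ω) : HasSegmentProperty Ω := by
  intro p hp
  by_cases hpΩ : p ∈ Ω
  · exact hasSegmentProperty_local_of_mem hΩ hpΩ
  obtain ⟨r, hr, e, he, γ, hγ, hgraph⟩ := h p (hΩ.frontier_eq ▸ ⟨hp, hpΩ⟩)
  refine ⟨r / 2, by positivity, (r / 2) • e, fun z hz hzb s hs => ?_⟩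
  have hs2 : 0 < s * (r / 2) := mul_pos hs.1 (by positivity)
  have hs3 : s * (r / 2) ≤ 1 * (r / 2) := mul_le_mul_of_nonneg_right hs.2 (by positivity)
  have hzr : z ∈ Metric.ball p r := Metric.ball_subset_ball (by linarith) hzb
  have hle : γ (z - inner ℝ e z • e) ≤ inner ℝ e z := by
    have hcl : IsClosed {x | γ (x - inner ℝ e x • e) ≤ inner ℝ e x} :=
      isClosed_le (by fun_prop) (by fun_prop)
    exact closure_minimal (fun x hx => ((hgraph x hx.1).1 hx.2).le) hcl
      (Metric.isOpen_ball.inter_closure ⟨hzr, hz⟩)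
  have hin : inner ℝ e (z + s • (r / 2) • e) = inner ℝ e z + s * (r / 2) := by
    simp [inner_add_right, inner_smul_right, he]
  rw [hgraph]
  · rw [hin, add_smul, smul_smul, add_sub_add_right_eq_sub]
    linarith
  · rw [Metric.mem_ball, dist_eq_norm] at hzb ⊢
    calc ‖z + s • (r / 2) • e - p‖ = ‖(z - p) + (s * (r / 2)) • e‖ := by
          rw [smul_smul]; congr 1; abel
      _ ≤ ‖z - p‖ + ‖(s * (r / 2)) • e‖ := norm_add_le _ _
      _ = ‖z - p‖ + s * (r / 2) := by rw [norm_smul, he, mul_one, Real.norm_of_nonneg hs2.le]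
      _ < r := by linarith

variable [FiniteDimensional ℝ V]

/-- A bounded set with the segment property has a smooth vector field `X` whose small
multiples move its closure into the set. The field is a combination of the local directions with
bump functions as coefficients. Its summands may be added one after the other: each keeps a point
of the closure in the closure, and moves it into the open set as soon as its coefficient is
positive. -/
lemma HasSegmentProperty.exists_inward_field {U : Set V} (hU : HasSegmentProperty U)
    (hK : IsCompact (closure U)) :
    ∃ X : V → V, ContDiff ℝ (⊤ : ℕ∞) X ∧
      ∀ᶠ s : ℝ in 𝓝[>] 0, ∀ z ∈ closure U, z + s • X z ∈ U := by
  choose! r hr v hv using hU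
  obtain ⟨t, htK, ht⟩ := hK.elim_nhds_subcover (fun p => Metric.ball p (r p / 2))
    fun p hp => Metric.ball_mem_nhds p (half_pos (hr p hp))
  classical
  -- The bumps are indexed by all points, but `r p > 0` is known only for `p` in the closure.
  let φ : ∀ p : V, ContDiffBump p := fun p =>
    if h : 0 < r p then ⟨r p / 4, r p / 2, by positivity, by linarith⟩ else default
  have hφ : ∀ p ∈ t, (φ p).rOut = r p / 2 := fun p hp => by
    simp only [φ, hr p (htK p hp), dif_pos]
  -- The partial sums of the field are bounded by `C`.
  let C : ℝ := 1 + ∑ p ∈ t, ‖v p‖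
  have hC : 0 < C := add_pos_of_pos_of_nonneg one_pos (Finset.sum_nonneg fun p _ => norm_nonneg _)
  refine ⟨fun z => ∑ p ∈ t, φ p z • v p,
    ContDiff.sum fun p _ => (φ p).contDiff.smul contDiff_const, ?_⟩
  have h1 : ∀ᶠ s : ℝ in 𝓝[>] 0, s ≤ 1 :=
    nhdsWithin_le_nhds ((gt_mem_nhds one_pos).mono fun s hs => le_of_lt hs)
  have h2 : ∀ᶠ s : ℝ in 𝓝[>] 0, ∀ p ∈ t, s * C < r p / 2 := by
    rw [eventually_all_finset]
    intro p hp
    have : Tendsto (fun s : ℝ => s * C) (𝓝[>] 0) (𝓝 (0 * C)) :=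
      (tendsto_id.mul_const C).mono_left nhdsWithin_le_nhds
    rw [zero_mul] at this
    exact this.eventually_lt_const (half_pos (hr p (htK p hp)))
  filter_upwards [h1, h2, self_mem_nhdsWithin] with s hs1 hsC hs0 z hz
  have hs0' : 0 < s := hs0
  have key : ∀ t' ⊆ t, z + s • ∑ p ∈ t', φ p z • v p ∈ closure U ∧
      ((∃ p ∈ t', φ p z ≠ 0) → z + s • ∑ p ∈ t', φ p z • v p ∈ U) := by
    intro t'
    induction t' using Finset.induction_on with
    | empty => intro _; simpa using hz
    | insert p t' hpt' ih =>
      intro hsub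
      obtain ⟨ihK, ihU⟩ := ih ((Finset.subset_insert _ _).trans hsub)
      have hpt : p ∈ t := hsub (Finset.mem_insert_self _ _)
      rw [Finset.sum_insert hpt']
      by_cases h0 : φ p z = 0
      · rw [h0, zero_smul, zero_add]
        refine ⟨ihK, fun ⟨q, hq, hq0⟩ => ihU ⟨q, ?_, hq0⟩⟩
        rcases Finset.mem_insert.1 hq with rfl | hq
        · exact absurd h0 hq0
        · exact hq
      · have hpos : 0 < φ p z := lt_of_le_of_ne (φ p).nonneg (Ne.symm h0)
        have hzp : dist z p < r p / 2 := by
          have : z ∈ Function.support (φ p) := h0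
          rwa [(φ p).support_eq, hφ p hpt] at this
        have hnorm : ‖s • ∑ p ∈ t', φ p z • v p‖ ≤ s * C := by
          rw [norm_smul, Real.norm_of_nonneg hs0'.le]
          refine mul_le_mul_of_nonneg_left ?_ hs0'.le
          calc ‖∑ p ∈ t', φ p z • v p‖ ≤ ∑ p ∈ t', ‖v p‖ := by
                refine norm_sum_le_of_le _ fun q _ => ?_
                rw [norm_smul, Real.norm_of_nonneg (φ q).nonneg]
                exact mul_le_of_le_one_left (norm_nonneg _) (φ q).le_one
            _ ≤ ∑ p ∈ t, ‖v p‖ := Finset.sum_le_sum_of_subset_of_nonneg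
                ((Finset.subset_insert _ _).trans hsub) fun q _ _ => norm_nonneg _
            _ ≤ C := by simp [C]
        have hmem := hv p (htK p hpt) _ ihK (by
          rw [Metric.mem_ball]
          calc dist (z + s • ∑ p ∈ t', φ p z • v p) p
              ≤ dist (z + s • ∑ p ∈ t', φ p z • v p) z + dist z p := dist_triangle _ _ _
            _ < r p := by
              rw [dist_eq_norm, add_sub_cancel_left]
              linarith [hsC p hpt]) (s * φ p z)
          ⟨mul_pos hs0' hpos, mul_le_one₀ hs1 hpos.le (φ p).le_one⟩
        have heq : z + s • (φ p z • v p + ∑ p ∈ t', φ p z • v p) =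
            z + s • ∑ p ∈ t', φ p z • v p + (s * φ p z) • v p := by
          rw [smul_add, smul_smul]; abel
        rw [heq]
        exact ⟨subset_closure hmem, fun _ => hmem⟩
  refine (key t subset_rfl).2 ?_
  obtain ⟨p, hp, hzp⟩ := mem_iUnion₂.1 (ht hz)
  refine ⟨p, hp, ?_⟩
  have : z ∈ Function.support (φ p) := by rwa [(φ p).support_eq, hφ p hp]
  exact this

end Inward

/-! ### Approximation by functions smooth up to the boundary -/

section Extension

variable {m : ℕ} {V : Type*} [NormedAddCommGroup V] [NormedSpace ℝ V]

variable [FiniteDimensional ℝ V]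

/-- A function which is `C^m` near a compact set agrees near it with a `C^m` function on the whole
space. -/
lemma exists_contDiff_eqOn_nhds {K W : Set V} (hK : IsCompact K) (hW : IsOpen W) (hKW : K ⊆ W)
    {g : V → ℝ} (hg : ContDiffOn ℝ m g W) :
    ∃ F : V → ℝ, ContDiff ℝ m F ∧ ∃ W', IsOpen W' ∧ K ⊆ W' ∧ EqOn F g W' := by
  obtain ⟨W₂, hW₂, hKW₂, hW₂W, hcW₂⟩ := exists_open_between_and_isCompact_closure hK hW hKW
  obtain ⟨W₁, hW₁, hKW₁, hW₁W, hcW₁⟩ := exists_open_between_and_isCompact_closure hK hW₂ hKW₂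
  obtain ⟨χ, hχ0, hχ1, -⟩ := exists_contMDiffMap_zero_one_of_isClosed (n := m)
    (modelWithCornersSelf ℝ V) (s := W₂ᶜ) (t := closure W₁) hW₂.isClosed_compl isClosed_closure
    (disjoint_compl_left_iff_subset.2 hW₁W)
  refine ⟨fun z => χ z * g z, contDiff_iff_contDiffAt.2 fun z => ?_, W₁, hW₁, hKW₁, fun z hz => ?_⟩
  · by_cases hz : z ∈ W
    · exact χ.contMDiff.contDiff.contDiffAt.mul (hg.contDiffAt (hW.mem_nhds hz))
    · have hz' : (closure W₂)ᶜ ∈ 𝓝 z :=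
        isClosed_closure.isOpen_compl.mem_nhds fun h => hz (hW₂W h)
      refine (contDiffAt_const (c := (0 : ℝ))).congr_of_eventuallyEq ?_
      filter_upwards [hz'] with y hy
      rw [hχ0 fun h => hy (subset_closure h)]
      simp
  · simp [hχ1 (subset_closure hz)]

/-- Suppose that `U` has the segment property and compact closure, and that the derivatives up to
order `m` of a `C^m` function `f` on `U` extend continuously to the closure. Then these
extensions are limits, uniformly on the closure, of the derivatives of `C^m` functions on the whole
space. The approximations are `f (z + s X z)` with `s → 0+`, for a vector field `X` pointing
inwards. -/
lemma mem_closure_jet_of_hasSegmentProperty {U : Set V} (hU : IsOpen U)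
    (hseg : HasSegmentProperty U) (hK : IsCompact (closure U)) {f : V → ℝ}
    (hf : ContDiffOn ℝ m f U) (P : C(closure U, Jet m V))
    (hP : ∀ z : closure U, (z : V) ∈ U → ∀ k, Jet.coeff k (P z) = iteratedFDeriv ℝ k f z) :
    P ∈ closure {Q : C(closure U, Jet m V) |
      ∃ (F : V → ℝ) (hF : ContDiff ℝ m F), jet (closure U) F hF = Q} := by
  obtain ⟨X, hX, hev⟩ := hseg.exists_inward_field hK
  obtain ⟨s₀, hs₀, hsub⟩ := mem_nhdsGT_iff_exists_Ioc_subset.1 hev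
  have hs₀' : 0 < s₀ := hs₀
  have hψ : ContDiff ℝ m fun p : ℝ × V => p.2 + p.1 • X p.2 :=
    contDiff_snd.add (contDiff_fst.smul ((hX.of_le (by exact_mod_cast le_top)).comp contDiff_snd))
  have hψs : ∀ s : ℝ, ContDiff ℝ m fun z : V => z + s • X z := fun s =>
    hψ.comp (contDiff_const.prodMk contDiff_id)
  have hmaps : ∀ (s : Icc 0 s₀) (z : closure U), (z : V) + (s : ℝ) • X z ∈ closure U := by
    intro s z
    rcases s.2.1.eq_or_lt with h | h
    · rw [← h]; simp
    · exact subset_closure (hsub ⟨h, s.2.2⟩ z z.2)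
  let ψ : Icc (0 : ℝ) s₀ × closure U → closure U := fun p =>
    ⟨(p.2 : V) + (p.1 : ℝ) • X p.2, hmaps p.1 p.2⟩
  have hinc : Continuous fun p : Icc (0 : ℝ) s₀ × closure U => ((p.1 : ℝ), (p.2 : V)) :=
    (continuous_subtype_val.comp continuous_fst).prodMk (continuous_subtype_val.comp continuous_snd)
  have hψc : Continuous ψ := (hψ.continuous.comp hinc).subtype_mk _
  -- The chain rule for `f (z + s X z)`, with the derivatives of `f` replaced by their extensions.
  let Q : C(Icc (0 : ℝ) s₀ × closure U, Jet m V) :=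
    ⟨fun p k => (P (ψ p)).toSeries.taylorComp
      (ftaylorSeries ℝ (fun z : V => z + (p.1 : ℝ) • X z) p.2) k,
    Jet.continuous_of_coeff fun k => continuous_taylorComp
      (q := fun p => (P (ψ p)).toSeries)
      (p := fun p : Icc (0 : ℝ) s₀ × closure U =>
        ftaylorSeries ℝ (fun z : V => z + (p.1 : ℝ) • X z) p.2)
      (fun i _ => Jet.continuous_toSeries.comp (P.continuous.comp hψc))
      (fun i hi => (continuous_iteratedFDeriv_param (h := fun (s : ℝ) (z : V) => z + s • X z) hψ
        (hi.trans (Nat.lt_succ_iff.1 k.2))).comp hinc)⟩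
  have hQ : ∀ (s : Icc (0 : ℝ) s₀) (z : closure U), (z : V) + (s : ℝ) • X z ∈ U → ∀ k,
      Jet.coeff k (Q (s, z)) = iteratedFDeriv ℝ k (f ∘ fun z : V => z + (s : ℝ) • X z) z := by
    intro s z hz k
    have h1 : iteratedFDeriv ℝ (k : ℕ) (f ∘ fun z : V => z + (s : ℝ) • X z) (z : V) =
        (ftaylorSeries ℝ f (z + (s : ℝ) • X z)).taylorComp
          (ftaylorSeries ℝ (fun z : V => z + (s : ℝ) • X z) z) k :=
      iteratedFDeriv_comp (f := fun z : V => z + (s : ℝ) • X z) (hf.contDiffAt (hU.mem_nhds hz))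
        (hψs s).contDiffAt (natCast_fin_le k)
    rw [h1]
    refine Finset.sum_congr rfl fun c _ => ?_
    unfold FormalMultilinearSeries.compAlongOrderedFinpartition
    have hc : c.length < m + 1 := lt_of_le_of_lt c.length_le k.2
    have h2 : (P (ψ (s, z))).toSeries c.length =
        ftaylorSeries ℝ f (z + (s : ℝ) • X z) c.length := by
      simp only [Jet.toSeries, hc, dif_pos]
      exact hP (ψ (s, z)) hz ⟨c.length, hc⟩
    rw [h2]
  have hQ0 : Q.curry ⟨0, le_rfl, hs₀'.le⟩ = P := by
    refine DFunLike.coe_injective (Continuous.ext_on (s := {z : closure U | (z : V) ∈ U}) ?_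
      (Q.curry _).continuous P.continuous fun z hz => Jet.ext fun k => ?_)
    · rw [Subtype.dense_iff]
      exact closure_mono fun z hz => ⟨⟨z, subset_closure hz⟩, hz, rfl⟩
    · refine (hQ ⟨0, le_rfl, hs₀'.le⟩ z (by simpa using hz) k).trans ?_
      rw [hP z hz k]
      congr 1
      ext y
      simp
  rw [← hQ0]
  let sq : ℕ → Icc (0 : ℝ) s₀ := fun n => ⟨s₀ * (1 / ((n : ℝ) + 1)), by positivity,
    mul_le_of_le_one_right hs₀'.le
      ((div_le_one (by positivity)).2 (by linarith [Nat.cast_nonneg (α := ℝ) n]))⟩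
  have hsq : Tendsto sq atTop (𝓝 ⟨0, le_rfl, hs₀'.le⟩) := by
    rw [tendsto_subtype_rng]
    simpa [sq] using (tendsto_one_div_add_atTop_nhds_zero_nat (𝕜 := ℝ)).const_mul s₀
  refine mem_closure_of_tendsto ((Q.curry.continuous.tendsto _).comp hsq)
    (Eventually.of_forall fun n => ?_)
  have hpos : 0 < (sq n : ℝ) := by simp only [sq]; positivity
  have hin : ∀ z ∈ closure U, z + (sq n : ℝ) • X z ∈ U := hsub ⟨hpos, (sq n).2.2⟩
  have hopen : IsOpen ((fun z : V => z + (sq n : ℝ) • X z) ⁻¹' U) :=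
    hU.preimage (hψs _).continuous
  obtain ⟨F, hF, W', hW', hKW', hFW'⟩ := exists_contDiff_eqOn_nhds hK hopen hin
    (hf.comp (hψs (sq n)).contDiffOn (mapsTo_preimage _ _))
  refine ⟨F, hF, ContinuousMap.ext fun z => Jet.ext fun k => ?_⟩
  refine Eq.trans ?_ (hQ (sq n) z (hin z z.2) k).symm
  exact ((hFW'.eventuallyEq_of_mem (hW'.mem_nhds (hKW' z.2))).iteratedFDeriv ℝ k).eq_of_nhds

end Extension

/-! ### Mixed partial derivatives -/

section MixedPartial

variable {d : ℕ}

/-- The vectors `coordVec d i` as a basis of space-time. -/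
noncomputable def coordBasis (d : ℕ) : Module.Basis (Fin d ⊕ Unit) ℝ (SpaceTime d) :=
  (EuclideanSpace.basisFun (Fin d) ℝ).toBasis.prod (Module.Basis.singleton Unit ℝ)

lemma coordBasis_apply (i : Fin d ⊕ Unit) : coordBasis d i = coordVec d i := by
  rcases i with i | i <;> simp [coordBasis, coordVec, Module.Basis.prod_apply]

lemma norm_coordVec (i : Fin d ⊕ Unit) : ‖coordVec d i‖ = 1 := by
  rcases i with i | i <;> simp [coordVec, Prod.norm_def]

/-- A multilinear form is a linear function of its values on the coordinate vectors, which is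
continuous since these values range over a finite-dimensional space. -/
lemma exists_reconstruction (d k : ℕ) :
    ∃ Λ : ((Fin k → Fin d ⊕ Unit) → ℝ) →L[ℝ]
        ContinuousMultilinearMap ℝ (fun _ : Fin k => SpaceTime d) ℝ,
      ∀ A, Λ (fun j => A fun a => coordVec d (j a)) = A := by
  let R : ContinuousMultilinearMap ℝ (fun _ : Fin k => SpaceTime d) ℝ →ₗ[ℝ]
      ((Fin k → Fin d ⊕ Unit) → ℝ) :=
    { toFun := fun A j => A fun a => coordVec d (j a)
      map_add' := fun _ _ => rfl
      map_smul' := fun _ _ => rfl }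
  have hR : LinearMap.ker R = ⊥ := by
    refine LinearMap.ker_eq_bot.2 fun A B hAB => ?_
    refine ContinuousMultilinearMap.toMultilinearMap_injective
      (Module.Basis.ext_multilinear (fun _ => coordBasis d) fun j => ?_)
    simp only [coordBasis_apply]
    exact congrFun hAB j
  obtain ⟨Λ, hΛ⟩ := R.exists_leftInverse_of_injective hR
  exact ⟨Λ.toContinuousLinearMap, fun A => LinearMap.congr_fun hΛ A⟩

/-- The continuous extensions of the partial derivatives of a member of `C^m(closure U)` assemble to
a continuous map from the closure to the space of jets. -/
lemma IsCmOnClosure.exists_jet {m : ℕ} {U : Set (SpaceTime d)} {f : SpaceTime d → ℝ}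
    (hf : IsCmOnClosure m U f) :
    ∃ P : C(closure U, Jet m (SpaceTime d)), ∀ z : closure U, (z : SpaceTime d) ∈ U →
      ∀ k, Jet.coeff k (P z) = iteratedFDeriv ℝ k f z := by
  choose Λ hΛ using exists_reconstruction d
  choose g hg hgU using fun k : Fin (m + 1) => hf.extends_derivs k (Nat.lt_succ_iff.1 k.2)
  refine ⟨⟨fun z k => Λ k fun j => g k j z, Jet.continuous_of_coeff fun k =>
    (Λ k).continuous.comp (continuous_pi fun j => (hg k j).domRestrict)⟩, fun z hz k => ?_⟩
  refine Eq.trans ?_ (hΛ k (iteratedFDeriv ℝ k f z))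
  exact congrArg (Λ k) (funext fun j => hgU k j hz)

lemma mixedPartialExt_eq {m : ℕ} {U : Set (SpaceTime d)} {f : SpaceTime d → ℝ}
    {P : C(closure U, Jet m (SpaceTime d))}
    (hP : ∀ z : closure U, (z : SpaceTime d) ∈ U → ∀ k,
      Jet.coeff k (P z) = iteratedFDeriv ℝ k f z)
    (k : Fin (m + 1)) (j : Fin k → Fin d ⊕ Unit) (z : closure U) :
    mixedPartialExt U j f z = Jet.coeff k (P z) fun a => coordVec d (j a) := by
  refine extendFrom_eq z.2 ?_
  have hc : Continuous fun w : closure U => Jet.coeff k (P w) fun a => coordVec d (j a) :=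
    ((Jet.coeff k).continuous.comp P.continuous).eval continuous_const
  intro s hs
  rw [mem_map]
  have hmem := mem_nhds_subtype_iff_nhdsWithin.1 (hc.continuousAt.preimage_mem_nhds hs)
  filter_upwards [nhdsWithin_mono _ subset_closure hmem, self_mem_nhdsWithin] with w hw hwU
  obtain ⟨w, hws, rfl⟩ := hw
  simpa only [mem_preimage, hP w hwU k, mixedPartial] using hws

end MixedPartial

theorem mainTheorem2 (d m L : ℕ) (hL : 1 ≤ L)
    (Ω : Set (EuclideanSpace ℝ (Fin d))) (hΩ_open : IsOpen Ω)
    (hΩ_bdd : Bornology.IsBounded Ω) (hΩ_bdry : HasContinuousBoundary Ω)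
    (T : ℝ) (hT : 0 < T)
    (σ : ℝ → ℝ) (hσ : ContDiff ℝ m σ) (hσ_bdd : ∃ M : ℝ, ∀ s, |σ s| ≤ M)
    (hσ_nonconst : ∃ s t : ℝ, σ s ≠ σ t) :
    UniformlyMDense m (Ω ×ˢ Ioo 0 T) (deepNetworks d L σ) := by
  obtain ⟨L, rfl⟩ : ∃ L', L = L' + 1 := ⟨L - 1, by omega⟩
  intro f hf ε hε
  have hU : IsOpen (Ω ×ˢ Ioo 0 T) := hΩ_open.prod isOpen_Ioo
  have hK : IsCompact (closure (Ω ×ˢ Ioo 0 T)) :=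
    (hΩ_bdd.prod (Metric.isBounded_Ioo 0 T)).isCompact_closure
  have hseg : HasSegmentProperty (Ω ×ˢ Ioo 0 T) :=
    (hΩ_bdry.hasSegmentProperty hΩ_open).prod (hasSegmentProperty_Ioo hT)
  have : CompactSpace (closure (Ω ×ˢ Ioo 0 T)) := isCompact_iff_compactSpace.1 hK
  obtain ⟨P, hP⟩ := hf.exists_jet
  have hPmem : P ∈ (jetMap m (closure (Ω ×ˢ Ioo 0 T)) (networkSpace d L σ)).topologicalClosure := by
    refine closure_minimal ?_ (Submodule.isClosed_topologicalClosure _)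
      (mem_closure_jet_of_hasSegmentProperty hU hseg hK hf.contDiffOn P hP)
    rintro _ ⟨F, hF, rfl⟩
    exact (mem_jetComap_networkSpace hσ hσ_bdd hσ_nonconst L hF).2
  obtain ⟨_, ⟨ξ, hξ, hξm, rfl⟩, hdist⟩ := Metric.mem_closure_iff.1 hPmem ε hε
  refine ⟨ξ, hξ, hξm, fun k hk j z hz => ?_⟩
  let k' : Fin (m + 1) := ⟨k, Nat.lt_succ_iff.2 hk⟩
  rw [mixedPartialExt_eq hP k' j ⟨z, hz⟩]
  have h1 := (Jet.coeff k' (jet _ ξ hξm ⟨z, hz⟩ - P ⟨z, hz⟩)).le_opNorm fun a => coordVec d (j a)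
  have h2 : ‖jet _ ξ hξm ⟨z, hz⟩ - P ⟨z, hz⟩‖ ≤ ε := by
    rw [← dist_eq_norm, dist_comm]
    exact (ContinuousMap.dist_apply_le_dist _).trans hdist.le
  simp only [norm_coordVec, Finset.prod_const_one, mul_one] at h1
  rw [map_sub] at h1
  exact (h1.trans (by rw [← map_sub]; exact Jet.norm_coeff_le _ _)).trans h2
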